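/- Let $\mathcal X$ be a metric space, $m,n\in\mathbb N$, and let $\mathcal X_1,\dots,\mathcal X_n\subseteq\mathcal X$ be open (not necessarily disjoint or covering). Let $\hat h:\mathcal X\to\{0,1\}^n$, $\hat h(x)_i=I_{\mathcal X_i}(x)$, be the associated ideal classifier, where $\{0,1\}^n$ carries the $n$-fold product of the Sierpiński topology $\{\emptyset,\{1\},\{0,1\}\}$. Let $\phi:\mathcal X\to\mathbb R^m$ be continuous and injective, let $\sigma:\mathbb R\to\mathbb R$ be continuous (hence locally bounded) and not of the form $t\mapsto at+b$ (for instance, any continuous non-polynomial $\sigma$), and let $\rho:\mathbb R^n\to(0,1)^n\subset[0,1]^n$, $\rho(y)_i=e^{y_i}/(1+e^{y_i})$, be the component-wise logistic map. Let $\mathcal{NN}$ be the set of feed-forward networks $\mathbb R^m\to\mathbb R^n$ with activation $\sigma$, i.e. the functions $f=W\circ f^{(J)}$ with $J\ge 1$ arbitrary, $f^{(0)}(x)=x$, $f^{(j)}(x)=\sigma\bullet\big(W^{(j)}f^{(j-1)}(x)\big)$ for $j=1,\dots,J$, where $W,W^{(1)},\dots,W^{(J)}$ are affine maps between finite-dimensional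 Euclidean spaces (arbitrary widths) and $\bullet$ is component-wise application. All spaces $C(\cdot,\cdot)$ of continuous functions on $\mathcal X$ carry the compact-open topology. Let $\alpha\in(0,1)$. Then: (i) (Hard-soft decomposition) There are $\hat s_1,\dots,\hat s_n\in C(\mathcal X,[0,1])$ with $\hat h=I_{(\alpha,1]}\bullet(\hat s_1,\dots,\hat s_n)$ and $\hat s_i^{-1}[(\alpha,1]]=\mathcal X_i$ for all $i$. (ii) (Universal classification) Suppose that $\phi$ is a homeomorphism onto its image, or that $\mathcal X$ is locally compact and $\sigma$-compact. Then for all $\hat s_1,\dots,\hat s_n\in C(\mathcal X,[0,1])$ with $\hat s_i^{-1}[(\alpha,1]]=\mathcal X_i$ for all $i$ there is a sequence $(f_k)_{k\in\mathbb N}$ in $\mathcal{NN}$ such that (a) (soft classification) for every non-empty compact $\kappa\subseteq\mathcal X$ and every $\epsilon>0$ there is $K$ with $$\sup_{x\in\kappa}\max_{i=1,\dots,n}\big|\rho(f_k(\phi(x)))_i-\hat s_i(x)\big|<\epsilon\qquad\text{for all }k\ge K;$$ (b) (hard classification) $I_{(\alpha,1]}\bullet(\rho\circ f_k\circ\phi)$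 converges to $\hat h$ in $C(\mathcal X,\{0,1\}^n)$ for the compact-open topology. (iii) The set $\{\rho\circ f\circ\phi : f\in\mathcal{NN}\}$ is dense in $C(\mathcal X,[0,1]^n)$. -/

import Mathlib

/-!
Conventions.  `ℝ^d` is `Fin d → ℝ`; only its topology, its affine structure and its coordinates
are used, so the choice of norm is immaterial.  `[0,1]^n` is `Fin n → unitInterval`.
`{0,1}^n` with the `n`-fold product of the Sierpinski topology is `Fin n → Prop`: Mathlib's topology
on `Prop` is the Sierpinski one, in which `{True}` is open and `{False}` is not (`True` is the
label `1`).  The topology on `C(X, Y)` is Mathlib's compact-open topology.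
-/

namespace UniversalClassification

/-- `IsHiddenLayer σ J d g`: `g : ℝ^m → ℝ^d` is a `J`-th layer `f^(J)` of a feed-forward network
with activation `σ`, that is, `f^(0)(x) = x` and `f^(j)(x) = σ • (W^(j) (f^(j-1) x))` with affine
maps `W^(j)` between spaces of arbitrary finite dimension (the widths of the layers). -/
inductive IsHiddenLayer (σ : ℝ → ℝ) {m : ℕ} :
    (J d : ℕ) → ((Fin m → ℝ) → (Fin d → ℝ)) → Prop
  | input : IsHiddenLayer σ 0 m (fun x => x)
  | layer {J d d' : ℕ} {g : (Fin m → ℝ) → (Fin d → ℝ)}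
      (W : (Fin d → ℝ) →ᵃ[ℝ] (Fin d' → ℝ)) (hg : IsHiddenLayer σ J d g) :
      IsHiddenLayer σ (J + 1) d' (fun x i => σ (W (g x) i))

/-- The set of feed-forward networks `ℝ^m → ℝ^n` with activation `σ`: the continuous functions
`f = W ∘ f^(J)` with `W` affine, and with an arbitrary number `J ≥ 1` of hidden layers. -/
def feedForward (σ : ℝ → ℝ) (m n : ℕ) : Set C(Fin m → ℝ, Fin n → ℝ) :=
  {f | ∃ (J d : ℕ) (g : (Fin m → ℝ) → (Fin d → ℝ)) (W : (Fin d → ℝ) →ᵃ[ℝ] (Fin n → ℝ)),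
    1 ≤ J ∧ IsHiddenLayer σ J d g ∧ ∀ x, f x = W (g x)}

/-- The component-wise logistic readout map `ρ : ℝ^n → [0,1]^n`, `ρ(y)_i = e^{y_i} / (1 + e^{y_i})`
(its image is `(0,1)^n`); Mathlib's sigmoid is `t ↦ (1 + e^{-t})⁻¹ = e^t / (1 + e^t)`. -/
noncomputable def logisticReadout (n : ℕ) : C(Fin n → ℝ, Fin n → unitInterval) where
  toFun y i := unitInterval.sigmoid (y i)
  continuous_toFun := continuous_pi fun i => unitInterval.continuous_sigmoid.comp (continuous_apply i)

/-- `F_{ρ,φ} = {g ∈ C(X, Y) : g = ρ ∘ f ∘ φ for some f ∈ F}`. -/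
def modifiedArchitecture {X Y : Type*} [TopologicalSpace X] [TopologicalSpace Y] {m n : ℕ}
    (F : Set C(Fin m → ℝ, Fin n → ℝ)) (ρ : C(Fin n → ℝ, Y)) (φ : C(X, Fin m → ℝ)) :
    Set C(X, Y) :=
  {g | ∃ f ∈ F, g = (ρ.comp f).comp φ}

/-- The ideal classifier `ĥ : X → {0,1}^n`, `ĥ(x)_i = 1` if `x ∈ U i` and `ĥ(x)_i = 0` otherwise. -/
def idealClassifier {X : Type*} [TopologicalSpace X] {n : ℕ} (U : Fin n → Set X)
    (hU : ∀ i, IsOpen (U i)) : C(X, Fin n → Prop) where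
  toFun x i := x ∈ U i
  continuous_toFun := continuous_pi fun i => isOpen_iff_continuous_mem.1 (hU i)

/-- The component-wise threshold `I_{(α,1]} : [0,1]^n → {0,1}^n`. -/
def threshold (n : ℕ) (α : ℝ) : C(Fin n → unitInterval, Fin n → Prop) where
  toFun y i := (y i : ℝ) ∈ Set.Ioc α 1
  continuous_toFun := by
    refine continuous_pi fun i => continuous_Prop.2 ?_
    have h : {y : Fin n → unitInterval | (y i : ℝ) ∈ Set.Ioc α 1} = {y | α < (y i : ℝ)} := by
      ext y
      simp [(y i).2.2]
    rw [h]
    exact isOpen_lt continuous_const (by fun_prop)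

end UniversalClassification

/-!
The core is that `feedForward σ m n` is dense in `C(ℝ^m, ℝ^n)` (`dense_feedForward`).

* One hidden layer. Let `S` be the closed span in `C(ℝ, ℝ)` of the functions `t ↦ σ (a t + b)`. It
  contains the mollifications of `σ`, and one of them, `f` say, is not affine. As
  `f (b + h t) - f b` is `h t f' b + o(h)`, and `f (b + h t) - f b - h t f' b` is
  `h² t² f'' b / 2 + o(h²)`, rescaling shows that `1`, `t` and `t²` lie in `S`
  (`pow_mem_of_not_affine`). By polarization, networks with one hidden layer approximate every map
  whose components are constants, coordinates or products of two coordinates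
  (`mem_closure_feedForward_of_isShallowLimit`).
* Depth. Limits of networks are closed under composition (`comp_mem_closure_feedForward`). A layer
  can copy the components of a tuple while appending the sum or the product of two of them. Hence
  the functions that can be appended to any realizable tuple containing the coordinates form a
  subalgebra (`adjoinable`), which separates points, and the Stone–Weierstrass theorem applies. No
  distinction between polynomial and non-polynomial `σ` is needed.

Density on `X` follows since, again by Stone–Weierstrass, composition with the injective `φ` has
dense range in `C(X, ℝ^n)`, and composition with the logistic map has dense range in
`C(X, [0,1]^n)`.

Density yields convergent sequences at once if `X` is locally compact and `σ`-compact, for then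
`C(X, [0,1]^n)` is first countable. If `φ` is an embedding, the target is first written as a
limit, uniform on the compact subsets of `X`, of continuous functions on all of `ℝ^m`
(`exists_tendsto_comp_of_isEmbedding`); the `k`-th of these is approximated by a network on the
ball of radius `k` in `ℝ^m`. Convergence of the hard classifiers follows from that of the soft ones,
because the threshold is continuous into the Sierpiński cube.
-/

open Filter Topology MeasureTheory

namespace UniversalClassification

/-! ### Monomials as limits of dilates and translates of a non-affine function -/

theorem mem_closure_of_forall_isCompact {X Y : Type*} [TopologicalSpace X] [PseudoMetricSpace Y]
    {S : Set C(X, Y)} {f : C(X, Y)}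
    (h : ∀ K : Set X, IsCompact K → ∀ ε : ℝ, 0 < ε → ∃ g ∈ S, ∀ x ∈ K, dist (g x) (f x) < ε) :
    f ∈ closure S := by
  have hb := nhds_basis_uniformity'
    (Metric.uniformity_basis_dist.compactConvergenceUniformity (α := X) (β := Y)) (x := f)
  rw [mem_closure_iff_nhds_basis hb]
  rintro ⟨K, ε⟩ ⟨hK, hε⟩
  obtain ⟨g, hg, hgK⟩ := h K hK ε hε
  exact ⟨g, hg, fun x hx => by simpa [dist_comm] using hgK x hx⟩

/-- The map `t ↦ a t + b`. -/
def affineLine (a b : ℝ) : C(ℝ, ℝ) := ⟨fun t => a * t + b, by fun_prop⟩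

@[simp] theorem affineLine_apply (a b t : ℝ) : affineLine a b t = a * t + b := rfl

theorem integral_mem_of_isClosed {E : Type*} [NormedAddCommGroup E] [NormedSpace ℝ E]
    [CompleteSpace E] (T : Submodule ℝ E) [hT : IsClosed (T : Set E)] {μ : Measure ℝ} {G : ℝ → E}
    (hG : Integrable G μ) (hmem : ∀ y, G y ∈ T) : ∫ y, G y ∂μ ∈ T := by
  have h := (T.mkQL).integral_comp_comm hG
  have h0 : ∀ y, T.mkQL (G y) = 0 := fun y => (Submodule.Quotient.mk_eq_zero T).2 (hmem y)
  simp only [h0, integral_zero] at h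
  exact (Submodule.Quotient.mk_eq_zero T).1 h.symm

/-- A closed space of continuous functions containing all translates of `f` contains the
mollifications of `f`: on a compact set `K`, the convolution `w ⋆ f` is the Bochner integral in `C(K, ℝ)`
of the translates of `f` with weight `w`. -/
theorem convolution_mem {S : Submodule ℝ C(ℝ, ℝ)} (hS : IsClosed (S : Set C(ℝ, ℝ)))
    {f : C(ℝ, ℝ)} (hf : ∀ b, f.comp (affineLine 1 b) ∈ S)
    {w : ℝ → ℝ} (hw : Continuous w) (hwc : HasCompactSupport w) (F : C(ℝ, ℝ))
    (hF : ∀ x, F x = convolution w f (ContinuousLinearMap.lsmul ℝ ℝ) volume x) : F ∈ S := by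
  rw [← SetLike.mem_coe, ← hS.closure_eq]
  refine mem_closure_of_forall_isCompact fun K hK ε hε => ?_
  have : CompactSpace K := isCompact_iff_compactSpace.1 hK
  let r : C(ℝ, ℝ) →L[ℝ] C(K, ℝ) :=
    ContinuousMap.compCLM ℝ ℝ (⟨Subtype.val, continuous_subtype_val⟩ : C(K, ℝ))
  let T : Submodule ℝ C(K, ℝ) := (S.map r.toLinearMap).topologicalClosure
  have hT : IsClosed (T : Set C(K, ℝ)) := Submodule.isClosed_topologicalClosure _
  let D : C(ℝ × K, ℝ) := ⟨fun p => w p.1 * f (p.2 - p.1), by fun_prop⟩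
  let G : ℝ → C(K, ℝ) := fun y => D.curry y
  have hGc : Continuous G := D.curry.continuous
  have hGr : ∀ y, G y = w y • r (f.comp (affineLine 1 (-y))) := by
    intro y
    ext x
    simp [G, D, r, ContinuousMap.compCLM, sub_eq_add_neg]
  have hGcs : HasCompactSupport G := by
    refine hwc.mono fun y hy => ?_
    contrapose! hy
    simp only [Function.mem_support, not_not] at hy ⊢
    rw [hGr, hy, zero_smul]
  have hGi : Integrable G := hGc.integrable_of_hasCompactSupport hGcs
  have hGT : ∀ y, G y ∈ T := fun y => by
    rw [hGr]
    exact T.smul_mem _ (Submodule.le_topologicalClosure _ ⟨_, hf _, rfl⟩)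
  have hmem : ∫ y, G y ∈ T := integral_mem_of_isClosed T hGi hGT
  obtain ⟨g, ⟨s, hs, rfl⟩, hg⟩ := Metric.mem_closure_iff.1 hmem ε hε
  refine ⟨s, hs, fun x hx => ?_⟩
  have h1 : (∫ y, G y) ⟨x, hx⟩ = F x := by
    rw [ContinuousMap.integral_apply hGi, hF, convolution]
    rfl
  have h2 := (ContinuousMap.dist_lt_iff hε).1 hg ⟨x, hx⟩
  rw [h1, dist_comm] at h2
  exact h2

/-- If `g u = c u ^ n + o(u ^ n)` at `0`, then the rescalings `h⁻ⁿ g (h t)` tend to `c t ^ n`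
locally uniformly as `h → 0`, so a closed space containing them contains `t ^ n`. -/
theorem monomial_mem {S : Submodule ℝ C(ℝ, ℝ)} (hS : IsClosed (S : Set C(ℝ, ℝ)))
    {g : C(ℝ, ℝ)} (hg : ∀ a, g.comp (affineLine a 0) ∈ S) {c : ℝ} (hc : c ≠ 0) {n : ℕ}
    (ho : (fun u => g u - c * u ^ n) =o[𝓝 0] fun u => u ^ n) :
    (ContinuousMap.id ℝ) ^ n ∈ S := by
  suffices h : c • (ContinuousMap.id ℝ) ^ n ∈ S by
    simpa [smul_smul, hc] using S.smul_mem c⁻¹ h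
  rw [← SetLike.mem_coe, ← hS.closure_eq]
  refine mem_closure_of_forall_isCompact fun K hK ε hε => ?_
  -- rescaling by `h` brings `K`, which lies in `[-R, R]`, into the `δ`-neighbourhood of `0`
  obtain ⟨R, hR, hKR⟩ : ∃ R : ℝ, 0 < R ∧ ∀ x ∈ K, |x| ≤ R := by
    obtain ⟨R, hR, h⟩ := hK.isBounded.exists_pos_norm_le
    exact ⟨R, hR, h⟩
  have hδ : 0 < ε / (2 * R ^ n) := by positivity
  obtain ⟨δ, hδ0, hδ⟩ := Metric.eventually_nhds_iff.1 (ho.def hδ)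
  set h : ℝ := δ / (2 * R) with hh
  have hh0 : 0 < h := by positivity
  refine ⟨(h ^ n)⁻¹ • g.comp (affineLine h 0), S.smul_mem _ (hg h), fun x hx => ?_⟩
  have hx' := hKR x hx
  have hdx : dist (h * x) 0 < δ := by
    rw [Real.dist_0_eq_abs, abs_mul, abs_of_pos hh0]
    calc h * |x| ≤ h * R := by gcongr
      _ = δ / 2 := by rw [hh]; field_simp
      _ < δ := by linarith
  have h1 := hδ hdx
  have hhn : 0 < h ^ n := by positivity
  simp only [Real.norm_eq_abs, abs_pow, abs_mul, abs_of_pos hh0] at h1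
  have h2 : (h ^ n)⁻¹ * g (h * x) - c * x ^ n = (h ^ n)⁻¹ * (g (h * x) - c * (h * x) ^ n) := by
    rw [mul_pow]; field_simp
  simp only [ContinuousMap.smul_apply, ContinuousMap.comp_apply, affineLine_apply, add_zero,
    ContinuousMap.pow_apply, ContinuousMap.id_apply, smul_eq_mul, Real.dist_eq]
  rw [h2, abs_mul, abs_of_pos (inv_pos.2 hhn)]
  calc (h ^ n)⁻¹ * |g (h * x) - c * (h * x) ^ n|
      ≤ (h ^ n)⁻¹ * (ε / (2 * R ^ n) * (h * |x|) ^ n) := by gcongr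
    _ = ε / (2 * R ^ n) * |x| ^ n := by rw [mul_pow]; field_simp
    _ ≤ ε / (2 * R ^ n) * R ^ n := by gcongr
    _ = ε / 2 := by field_simp
    _ < ε := by linarith

/-- A closed space of continuous functions containing all `f (a t + b)` for a `C²` function `f`
which is not affine contains `1`, `t` and `t²`. -/
theorem pow_mem_of_contDiff {S : Submodule ℝ C(ℝ, ℝ)} (hS : IsClosed (S : Set C(ℝ, ℝ)))
    {f : C(ℝ, ℝ)} (hf : ∀ a b, f.comp (affineLine a b) ∈ S) (hf2 : ContDiff ℝ 2 f)
    (hna : ¬ ∃ a b : ℝ, ∀ t, f t = a * t + b) :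
    (ContinuousMap.id ℝ) ^ 0 ∈ S ∧ (ContinuousMap.id ℝ) ^ 1 ∈ S ∧
      (ContinuousMap.id ℝ) ^ 2 ∈ S := by
  have hd1 : Differentiable ℝ f := hf2.differentiable (by norm_num)
  have hd2 : Differentiable ℝ (deriv f) :=
    (contDiff_succ_iff_deriv.1 (show ContDiff ℝ (1 + 1) f from hf2)).2.2.differentiable (by norm_num)
  obtain ⟨b₁, hb₁⟩ : ∃ b, deriv f b ≠ 0 := by
    by_contra! h
    exact hna ⟨0, f 0, fun t => by simpa using is_const_of_deriv_eq_zero hd1 h t 0⟩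
  obtain ⟨b₂, hb₂⟩ : ∃ b, deriv (deriv f) b ≠ 0 := by
    by_contra! h
    have hc := is_const_of_deriv_eq_zero hd2 h
    have hd : Differentiable ℝ fun t => f t - deriv f 0 * t := by fun_prop
    have h0 : ∀ t, deriv (fun t => f t - deriv f 0 * t) t = 0 := fun t => by
      have := ((hd1 t).hasDerivAt.sub ((hasDerivAt_id t).const_mul (deriv f 0))).deriv
      simp only [hc t 0, mul_one, sub_self] at this
      exact this
    refine hna ⟨deriv f 0, f 0, fun t => ?_⟩
    have := is_const_of_deriv_eq_zero hd h0 t 0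
    simp at this
    linarith
  have m0 : (ContinuousMap.id ℝ) ^ 0 ∈ S := by
    obtain ⟨c, hc⟩ : ∃ c, f c ≠ 0 := by
      by_contra! h
      exact hna ⟨0, 0, fun t => by simp [h t]⟩
    have := S.smul_mem (f c)⁻¹ (hf 0 c)
    convert this using 1
    ext t
    simp [hc]
  have m0' : ∀ c : ℝ, ContinuousMap.const ℝ c ∈ S := fun c => by
    convert S.smul_mem c m0 using 1
    ext t
    simp
  have htend : ∀ b : ℝ, Tendsto (fun u => b + u) (𝓝 0) (𝓝 b) := fun b => by
    have : Continuous fun u : ℝ => b + u := by fun_prop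
    simpa using this.tendsto 0
  have m1 : (ContinuousMap.id ℝ) ^ 1 ∈ S := by
    refine monomial_mem hS (g := f.comp (affineLine 1 b₁) - ContinuousMap.const ℝ (f b₁)) ?_ hb₁ ?_
    · intro a
      convert S.sub_mem (hf a b₁) (m0' (f b₁)) using 1
      ext t
      simp
    · have := (taylor_isLittleO_univ (x₀ := b₁) (n := 1) (hf2.of_le (by norm_num))).comp_tendsto
        (htend b₁)
      refine this.congr (fun u => ?_) (fun u => ?_)
      · simp [taylorWithinEval_succ, taylor_within_zero_eval, iteratedDerivWithin_univ,
          iteratedDeriv_one, add_comm]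
        ring
      · simp
  refine ⟨m0, m1, ?_⟩
  refine monomial_mem hS (g := f.comp (affineLine 1 b₂) - ContinuousMap.const ℝ (f b₂)
    - deriv f b₂ • (ContinuousMap.id ℝ) ^ 1) (c := deriv (deriv f) b₂ / 2) ?_ (by simpa using hb₂) ?_
  · intro a
    convert S.sub_mem (S.sub_mem (hf a b₂) (m0' (f b₂))) (S.smul_mem (deriv f b₂ * a) m1) using 1
    ext t
    simp
    ring
  · have := (taylor_isLittleO_univ (x₀ := b₂) (n := 2) hf2).comp_tendsto (htend b₂)
    refine this.congr (fun u => ?_) (fun u => ?_)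
    · simp [taylorWithinEval_succ, taylor_within_zero_eval, iteratedDerivWithin_univ,
          iteratedDeriv_succ, iteratedDeriv_zero, add_comm]
      ring
    · simp

theorem affine_of_pointwise_limit {F : ℕ → ℝ → ℝ} {f : ℝ → ℝ}
    (hlim : ∀ t, Tendsto (fun k => F k t) atTop (𝓝 (f t)))
    (hF : ∀ k, ∃ a b : ℝ, ∀ t, F k t = a * t + b) : ∃ a b : ℝ, ∀ t, f t = a * t + b := by
  refine ⟨f 1 - f 0, f 0, fun t => ?_⟩
  have h1 : Tendsto (fun k => (F k 1 - F k 0) * t + F k 0) atTop (𝓝 ((f 1 - f 0) * t + f 0)) :=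
    (((hlim 1).sub (hlim 0)).mul_const t).add (hlim 0)
  refine tendsto_nhds_unique (hlim t) (h1.congr fun k => ?_)
  obtain ⟨a, b, h⟩ := hF k
  simp only [h]
  ring

/-- The smoothness assumption of `pow_mem_of_contDiff` is removed by mollification: some
mollification of `σ` is not affine, since they converge pointwise to `σ`. -/
theorem pow_mem_of_not_affine {S : Submodule ℝ C(ℝ, ℝ)} (hS : IsClosed (S : Set C(ℝ, ℝ)))
    (hinv : ∀ f ∈ S, ∀ a b, f.comp (affineLine a b) ∈ S) {σ : C(ℝ, ℝ)} (hσ : σ ∈ S)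
    (hna : ¬ ∃ a b : ℝ, ∀ t, σ t = a * t + b) :
    (ContinuousMap.id ℝ) ^ 0 ∈ S ∧ (ContinuousMap.id ℝ) ^ 1 ∈ S ∧
      (ContinuousMap.id ℝ) ^ 2 ∈ S := by
  let w : ℕ → ContDiffBump (0 : ℝ) := fun k =>
    ⟨1 / (k + 2 : ℝ), 1 / (k + 1 : ℝ), by positivity, by gcongr; norm_num⟩
  let F : ℕ → ℝ → ℝ := fun k =>
    convolution ((w k).normed volume) σ (ContinuousLinearMap.lsmul ℝ ℝ) volume
  have hsmooth : ∀ k, ContDiff ℝ 2 (F k) := fun k =>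
    (w k).hasCompactSupport_normed.contDiff_convolution_left (n := 2) _ (w k).contDiff_normed
      σ.continuous.locallyIntegrable
  have hlim : ∀ t, Tendsto (fun k => F k t) atTop (𝓝 (σ t)) := fun t =>
    ContDiffBump.convolution_tendsto_right_of_continuous
      (tendsto_one_div_add_atTop_nhds_zero_nat) σ.continuous t
  obtain ⟨k, hk⟩ : ∃ k, ¬ ∃ a b : ℝ, ∀ t, F k t = a * t + b := by
    by_contra! h
    exact hna (affine_of_pointwise_limit hlim h)
  let G : C(ℝ, ℝ) := ⟨F k, (hsmooth k).continuous⟩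
  have hG : G ∈ S := convolution_mem hS (hinv σ hσ 1) (w k).continuous_normed
    (w k).hasCompactSupport_normed G fun _ => rfl
  exact pow_mem_of_contDiff hS (hinv G hG) (hsmooth k) hk

/-! ### Networks with one hidden layer, and composition of networks -/

/-- The map `x ↦ ψ (ℓ x) c` from `ℝ^a` to `ℝ^b`. -/
def ridge {a b : ℕ} (ψ : C(ℝ, ℝ)) (ℓ : (Fin a → ℝ) →ᵃ[ℝ] ℝ) (c : Fin b → ℝ) :
    C(Fin a → ℝ, Fin b → ℝ) :=
  ⟨fun x => ψ (ℓ x) • c, by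
    have : Continuous ℓ := ℓ.continuous_of_finiteDimensional
    fun_prop⟩

@[simp] theorem ridge_apply {a b : ℕ} (ψ : C(ℝ, ℝ)) (ℓ : (Fin a → ℝ) →ᵃ[ℝ] ℝ) (c : Fin b → ℝ)
    (x : Fin a → ℝ) (i : Fin b) : ridge ψ ℓ c x i = ψ (ℓ x) * c i := rfl

/-- The space of networks `ℝ^a → ℝ^b` with one hidden layer and a linear output map. -/
def shallow (σ : C(ℝ, ℝ)) (a b : ℕ) : Submodule ℝ C(Fin a → ℝ, Fin b → ℝ) :=
  Submodule.span ℝ {f | ∃ ℓ c, f = ridge σ ℓ c}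

theorem shallow_subset_feedForward (σ : C(ℝ, ℝ)) (a b : ℕ) :
    (shallow σ a b : Set C(Fin a → ℝ, Fin b → ℝ)) ⊆ feedForward σ a b := by
  intro f hf
  obtain ⟨d, r, g, rfl⟩ := Submodule.mem_span_set'.1 hf
  choose ℓ c hg using fun k => (g k).2
  refine ⟨1, d, fun x i => σ (AffineMap.pi ℓ x i),
    (∑ k, (LinearMap.proj k : (Fin d → ℝ) →ₗ[ℝ] ℝ).smulRight (r k • c k)).toAffineMap,
    le_rfl, .layer _ .input, fun x => ?_⟩
  ext i
  simp only [hg, LinearMap.coe_toAffineMap, LinearMap.sum_apply, LinearMap.smulRight_apply,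
    ContinuousMap.coe_sum, Finset.sum_apply, ContinuousMap.coe_smul, Pi.smul_apply, ridge_apply,
    LinearMap.proj_apply, smul_eq_mul, AffineMap.pi_apply]
  exact Finset.sum_congr rfl fun k _ => by ring

/-- Post-composing with a network only lengthens the network: the affine output map of the first
network is absorbed by the first hidden layer of the second. -/
theorem IsHiddenLayer.comp {σ : ℝ → ℝ} {a d b : ℕ} {J₁ : ℕ} {g : (Fin a → ℝ) → (Fin d → ℝ)}
    (hg : IsHiddenLayer σ J₁ d g) (W : (Fin d → ℝ) →ᵃ[ℝ] (Fin b → ℝ)) {J e : ℕ}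
    {h : (Fin b → ℝ) → (Fin e → ℝ)} (hh : IsHiddenLayer σ J e h) :
    ∃ (d' : ℕ) (g' : (Fin a → ℝ) → (Fin d' → ℝ)) (W' : (Fin d' → ℝ) →ᵃ[ℝ] (Fin e → ℝ)),
      IsHiddenLayer σ (J₁ + J) d' g' ∧ ∀ x, h (W (g x)) = W' (g' x) := by
  induction hh with
  | input => exact ⟨d, g, W, hg, fun _ => rfl⟩
  | @layer J e e' h V hh ih =>
    obtain ⟨d', g', W', hg', hW'⟩ := ih
    refine ⟨e', _, AffineMap.id ℝ _, .layer (V.comp W') hg', fun x => ?_⟩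
    simp [hW']

theorem comp_mem_feedForward {σ : ℝ → ℝ} {a b c : ℕ} {f : C(Fin a → ℝ, Fin b → ℝ)}
    {g : C(Fin b → ℝ, Fin c → ℝ)} (hf : f ∈ feedForward σ a b) (hg : g ∈ feedForward σ b c) :
    g.comp f ∈ feedForward σ a c := by
  obtain ⟨J, d, u, W, hJ, hu, hf⟩ := hf
  obtain ⟨J', d', u', W', hJ', hu', hg⟩ := hg
  obtain ⟨e, v, V, hv, hV⟩ := hu.comp W hu'
  exact ⟨J + J', e, v, W'.comp V, by omega, hv, fun x => by simp [hf, hg, hV]⟩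

theorem comp_mem_closure_feedForward {σ : ℝ → ℝ} {a b c : ℕ} {f : C(Fin a → ℝ, Fin b → ℝ)}
    {g : C(Fin b → ℝ, Fin c → ℝ)} (hf : f ∈ closure (feedForward σ a b))
    (hg : g ∈ closure (feedForward σ b c)) : g.comp f ∈ closure (feedForward σ a c) :=
  map_mem_closure₂ (f := fun f g => ContinuousMap.comp g f) ContinuousMap.continuous_comp' hf hg
    fun _ hf _ hg => comp_mem_feedForward hf hg

/-- The closed span of the functions `t ↦ σ (a t + b)`. -/
def ridgeProfiles (σ : C(ℝ, ℝ)) : Submodule ℝ C(ℝ, ℝ) :=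
  (Submodule.span ℝ {f | ∃ a b, f = σ.comp (affineLine a b)}).topologicalClosure

theorem ridgeProfiles_comp_affineLine (σ : C(ℝ, ℝ)) {f : C(ℝ, ℝ)} (hf : f ∈ ridgeProfiles σ)
    (a b : ℝ) : f.comp (affineLine a b) ∈ ridgeProfiles σ := by
  let L := ContinuousMap.compCLM ℝ ℝ (affineLine a b)
  suffices h : ridgeProfiles σ ≤ (ridgeProfiles σ).comap L.toLinearMap from h hf
  refine Submodule.topologicalClosure_minimal _ (Submodule.span_le.2 ?_)
    ((Submodule.isClosed_topologicalClosure _).preimage L.continuous)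
  rintro _ ⟨p, q, rfl⟩
  refine Submodule.le_topologicalClosure _ (Submodule.subset_span ⟨p * a, p * b + q, ?_⟩)
  ext t
  simp only [L, ContinuousMap.compCLM, ContinuousLinearMap.coe_mk, LinearMap.coe_mk, AddHom.coe_mk,
    ContinuousMap.comp_apply, affineLine_apply]
  congr 1
  ring

theorem ridge_mem_closure_shallow {σ ψ : C(ℝ, ℝ)} (hψ : ψ ∈ ridgeProfiles σ) {a b : ℕ}
    (ℓ : (Fin a → ℝ) →ᵃ[ℝ] ℝ) (c : Fin b → ℝ) :
    ridge ψ ℓ c ∈ (shallow σ a b).topologicalClosure := by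
  let L : C(ℝ, ℝ) →L[ℝ] C(Fin a → ℝ, Fin b → ℝ) :=
    ((ContinuousLinearMap.id ℝ ℝ).smulRight c).compLeftContinuous ℝ (Fin a → ℝ) ∘L
      ContinuousMap.compCLM ℝ ℝ ⟨ℓ, ℓ.continuous_of_finiteDimensional⟩
  have hL : ∀ f, L f = ridge f ℓ c := fun f => rfl
  suffices h : ridgeProfiles σ ≤ (shallow σ a b).topologicalClosure.comap L.toLinearMap by
    simpa [hL] using h hψ
  refine Submodule.topologicalClosure_minimal _ (Submodule.span_le.2 ?_)
    ((Submodule.isClosed_topologicalClosure _).preimage L.continuous)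
  rintro _ ⟨p, q, rfl⟩
  refine Submodule.le_topologicalClosure _ (Submodule.subset_span
    ⟨p • ℓ + AffineMap.const ℝ _ q, c, ?_⟩)
  ext x i
  simp [L, ContinuousMap.compCLM]

theorem pow_mem_ridgeProfiles {σ : C(ℝ, ℝ)} (hna : ¬ ∃ a b : ℝ, ∀ t, σ t = a * t + b) :
    (ContinuousMap.id ℝ) ^ 0 ∈ ridgeProfiles σ ∧ (ContinuousMap.id ℝ) ^ 1 ∈ ridgeProfiles σ ∧
      (ContinuousMap.id ℝ) ^ 2 ∈ ridgeProfiles σ := by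
  refine pow_mem_of_not_affine (Submodule.isClosed_topologicalClosure _)
    (fun f hf => ridgeProfiles_comp_affineLine σ hf) ?_ hna
  refine Submodule.le_topologicalClosure _ (Submodule.subset_span ⟨1, 0, ?_⟩)
  ext t
  simp

/-! ### Products, and the algebra of adjoinable functions -/

/-- The `i`-th coordinate function on `ℝ^a`. -/
def coord {a : ℕ} (i : Fin a) : C(Fin a → ℝ, ℝ) := ⟨fun x => x i, continuous_apply i⟩

@[simp] theorem coord_apply {a : ℕ} (i : Fin a) (x : Fin a → ℝ) : coord i x = x i := rfl

/-- The map `x ↦ q x • c`. -/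
def smulConst {a b : ℕ} (q : C(Fin a → ℝ, ℝ)) (c : Fin b → ℝ) : C(Fin a → ℝ, Fin b → ℝ) :=
  ⟨fun x => q x • c, by fun_prop⟩

@[simp] theorem smulConst_apply {a b : ℕ} (q : C(Fin a → ℝ, ℝ)) (c : Fin b → ℝ) (x : Fin a → ℝ)
    (i : Fin b) : smulConst q c x i = q x * c i := rfl

/-- A scalar function `q` on `ℝ^a` is a shallow limit if every vector multiple of it is a locally
uniform limit of networks with one hidden layer. -/
def IsShallowLimit (σ : C(ℝ, ℝ)) {a : ℕ} (q : C(Fin a → ℝ, ℝ)) : Prop :=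
  ∀ (b : ℕ) (c : Fin b → ℝ), smulConst q c ∈ (shallow σ a b).topologicalClosure

theorem isShallowLimit_const {σ : C(ℝ, ℝ)} (hna : ¬ ∃ a b : ℝ, ∀ t, σ t = a * t + b) {a : ℕ}
    (r : ℝ) : IsShallowLimit σ (ContinuousMap.const (Fin a → ℝ) r) := fun b c => by
  convert ridge_mem_closure_shallow (pow_mem_ridgeProfiles hna).1 (0 : (Fin a → ℝ) →ᵃ[ℝ] ℝ) (r • c)
  ext x i
  simp

theorem isShallowLimit_coord {σ : C(ℝ, ℝ)} (hna : ¬ ∃ a b : ℝ, ∀ t, σ t = a * t + b) {a : ℕ}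
    (i : Fin a) : IsShallowLimit σ (coord i) := fun b c => by
  convert ridge_mem_closure_shallow (pow_mem_ridgeProfiles hna).2.1
    (LinearMap.proj i : (Fin a → ℝ) →ₗ[ℝ] ℝ).toAffineMap c
  ext x i
  simp

theorem IsShallowLimit.add {σ : C(ℝ, ℝ)} {a : ℕ} {p q : C(Fin a → ℝ, ℝ)}
    (hp : IsShallowLimit σ p) (hq : IsShallowLimit σ q) : IsShallowLimit σ (p + q) := fun b c => by
  convert Submodule.add_mem _ (hp b c) (hq b c)
  ext x i
  simp [add_mul]

/-- By polarization, `4 x_i x_j = (x_i + x_j)² - (x_i - x_j)²`, products of two coordinates are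
combinations of squares of linear forms. -/
theorem isShallowLimit_coord_mul {σ : C(ℝ, ℝ)} (hna : ¬ ∃ a b : ℝ, ∀ t, σ t = a * t + b) {a : ℕ}
    (i j : Fin a) : IsShallowLimit σ (coord i * coord j) := fun b c => by
  let p : Fin a → (Fin a → ℝ) →ₗ[ℝ] ℝ := LinearMap.proj
  have h := fun ℓ : (Fin a → ℝ) →ₗ[ℝ] ℝ =>
    ridge_mem_closure_shallow (pow_mem_ridgeProfiles hna).2.2 ℓ.toAffineMap ((4 : ℝ)⁻¹ • c)
  convert Submodule.sub_mem _ (h (p i + p j)) (h (p i - p j))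
  ext x k
  simp [p]
  ring

theorem mem_closure_feedForward_of_isShallowLimit {σ : C(ℝ, ℝ)} {a b : ℕ}
    {F : C(Fin a → ℝ, Fin b → ℝ)} (hF : ∀ k, IsShallowLimit σ ((coord k).comp F)) :
    F ∈ closure (feedForward σ a b) := by
  refine closure_mono (shallow_subset_feedForward σ a b) ?_
  have h : F = ∑ k, smulConst ((coord k).comp F) (Pi.single k 1) := by
    ext x i
    simp [ContinuousMap.sum_apply, Pi.single_apply]
  rw [h]
  exact Submodule.sum_mem (shallow σ a b).topologicalClosure fun k _ => hF k b _

/-- The functions in `T` are simultaneously realizable if they occur among the components of one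
map `ℝ^m → ℝ^d` which is a locally uniform limit of networks. -/
def Realizable (σ : C(ℝ, ℝ)) {m : ℕ} (T : Set C(Fin m → ℝ, ℝ)) : Prop :=
  ∃ (d : ℕ) (F : C(Fin m → ℝ, Fin d → ℝ)), F ∈ closure (feedForward σ m d) ∧
    ∀ f ∈ T, ∃ i, f = (coord i).comp F

theorem Realizable.mono {σ : C(ℝ, ℝ)} {m : ℕ} {T T' : Set C(Fin m → ℝ, ℝ)}
    (h : Realizable σ T') (hT : T ⊆ T') : Realizable σ T :=
  let ⟨d, F, hF, hFT⟩ := h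
  ⟨d, F, hF, fun f hf => hFT f (hT hf)⟩

theorem realizable_coord {σ : C(ℝ, ℝ)} (hna : ¬ ∃ a b : ℝ, ∀ t, σ t = a * t + b) (m : ℕ) :
    Realizable σ (Set.range (coord (a := m))) := by
  refine ⟨m, .id _, mem_closure_feedForward_of_isShallowLimit fun k => isShallowLimit_coord hna k,
    ?_⟩
  rintro _ ⟨i, rfl⟩
  exact ⟨i, rfl⟩

/-- One more hidden layer, in the limit, appends to a realized tuple `F` a new component `q ∘ F`
while copying the old components. -/
theorem realizable_insert {σ : C(ℝ, ℝ)} (hna : ¬ ∃ a b : ℝ, ∀ t, σ t = a * t + b) {m d : ℕ}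
    {F : C(Fin m → ℝ, Fin d → ℝ)} (hF : F ∈ closure (feedForward σ m d)) {T : Set C(Fin m → ℝ, ℝ)}
    (hT : ∀ f ∈ T, ∃ i, f = (coord i).comp F) {q : C(Fin d → ℝ, ℝ)} (hq : IsShallowLimit σ q) :
    Realizable σ (insert (q.comp F) T) := by
  let G : C(Fin d → ℝ, Fin (d + 1) → ℝ) := ⟨fun x => Fin.cons (q x) x, by fun_prop⟩
  have h0 : (coord 0).comp G = q := rfl
  have hs : ∀ i : Fin d, (coord i.succ).comp G = coord i := fun i => rfl
  refine ⟨d + 1, G.comp F, comp_mem_closure_feedForward hF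
    (mem_closure_feedForward_of_isShallowLimit fun k => ?_), ?_⟩
  · cases k using Fin.cases with
    | zero => rwa [h0]
    | succ i => rw [hs]; exact isShallowLimit_coord hna i
  · rintro f (rfl | hf)
    · exact ⟨0, rfl⟩
    · obtain ⟨i, rfl⟩ := hT f hf
      exact ⟨i.succ, rfl⟩

/-- The functions that can be adjoined to every realizable family containing the coordinates.
They form a subalgebra since sums and products of two components of a realized tuple can be
appended to the tuple. -/
def adjoinable (σ : C(ℝ, ℝ)) (hna : ¬ ∃ a b : ℝ, ∀ t, σ t = a * t + b) (m : ℕ) :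
    Subalgebra ℝ C(Fin m → ℝ, ℝ) where
  carrier := {f | ∀ T, Set.range coord ⊆ T → Realizable σ T → Realizable σ (insert f T)}
  algebraMap_mem' r := by
    rintro T - ⟨d, F, hF, hT⟩
    exact realizable_insert hna hF hT (isShallowLimit_const hna r)
  add_mem' {f g} hf hg := by
    intro T hT hr
    obtain ⟨d, F, hF, hFT⟩ := hg _ (hT.trans (Set.subset_insert f T)) (hf T hT hr)
    obtain ⟨j, rfl⟩ := hFT g (by simp)
    obtain ⟨i, rfl⟩ := hFT f (by simp)
    refine (realizable_insert hna hF hFT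
      ((isShallowLimit_coord hna i).add (isShallowLimit_coord hna j))).mono ?_
    exact Set.insert_subset_insert fun f hf => by simp [hf]
  mul_mem' {f g} hf hg := by
    intro T hT hr
    obtain ⟨d, F, hF, hFT⟩ := hg _ (hT.trans (Set.subset_insert f T)) (hf T hT hr)
    obtain ⟨j, rfl⟩ := hFT g (by simp)
    obtain ⟨i, rfl⟩ := hFT f (by simp)
    refine (realizable_insert hna hF hFT (isShallowLimit_coord_mul hna i j)).mono ?_
    exact Set.insert_subset_insert fun f hf => by simp [hf]

theorem coord_mem_adjoinable {σ : C(ℝ, ℝ)} (hna : ¬ ∃ a b : ℝ, ∀ t, σ t = a * t + b) {m : ℕ}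
    (i : Fin m) : coord i ∈ adjoinable σ hna m := fun T hT hr => by
  rwa [Set.insert_eq_of_mem (hT ⟨i, rfl⟩)]

theorem mem_closure_feedForward_of_mem_adjoinable {σ : C(ℝ, ℝ)}
    (hna : ¬ ∃ a b : ℝ, ∀ t, σ t = a * t + b) {m n : ℕ} {F : C(Fin m → ℝ, Fin n → ℝ)}
    (hF : ∀ i, (coord i).comp F ∈ adjoinable σ hna m) : F ∈ closure (feedForward σ m n) := by
  have key : ∀ s : Finset (Fin n), Realizable σ
      ((fun i => (coord i).comp F) '' (s : Set (Fin n)) ∪ Set.range coord) := by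
    intro s
    induction s using Finset.induction_on with
    | empty => simpa using realizable_coord hna m
    | insert i s _ ih =>
      rw [Finset.coe_insert, Set.image_insert_eq, Set.insert_union]
      exact hF i _ Set.subset_union_right ih
  obtain ⟨d, G, hG, hGT⟩ := key Finset.univ
  choose k hk using fun i => hGT ((coord i).comp F) (Or.inl ⟨i, by simp, rfl⟩)
  let P : C(Fin d → ℝ, Fin n → ℝ) := ⟨fun x i => x (k i), by fun_prop⟩
  have hFP : F = P.comp G := by
    ext x i
    exact DFunLike.congr_fun (hk i) x
  rw [hFP]
  exact comp_mem_closure_feedForward hG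
    (mem_closure_feedForward_of_isShallowLimit fun i => isShallowLimit_coord hna (k i))

/-! ### Density -/

/-- The vector-valued Stone–Weierstrass theorem for the compact-open topology. -/
theorem dense_of_separatesPoints {X : Type*} [TopologicalSpace X] {A : Subalgebra ℝ C(X, ℝ)}
    (hA : A.SeparatesPoints) (n : ℕ) :
    Dense {F : C(X, Fin n → ℝ) | ∀ i, (coord i).comp F ∈ A} := by
  refine fun F => mem_closure_of_forall_isCompact fun K hK ε hε => ?_
  choose g hgA hg using fun i =>
    ContinuousMap.exists_mem_subalgebra_near_continuous_of_isCompact_of_separatesPoints hA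
      ((coord i).comp F) hK hε
  refine ⟨.pi g, fun i => hgA i, fun x hx => ?_⟩
  rw [dist_pi_lt_iff hε]
  exact fun i => hg i x hx

theorem dense_feedForward {σ : C(ℝ, ℝ)} (hna : ¬ ∃ a b : ℝ, ∀ t, σ t = a * t + b) (m n : ℕ) :
    Dense (feedForward σ m n) := by
  have hsep : (adjoinable σ hna m).SeparatesPoints := fun x y hxy => by
    obtain ⟨i, hi⟩ := Function.ne_iff.1 hxy
    exact ⟨coord i, ⟨coord i, coord_mem_adjoinable hna i, rfl⟩, hi⟩
  refine dense_closure.1 ((dense_of_separatesPoints hsep n).mono fun F hF => ?_)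
  exact mem_closure_feedForward_of_mem_adjoinable hna hF

theorem denseRange_comp_right {X : Type*} [TopologicalSpace X] {m n : ℕ} (φ : C(X, Fin m → ℝ))
    (hφ : Function.Injective φ) :
    DenseRange fun f : C(Fin m → ℝ, Fin n → ℝ) => f.comp φ := by
  let A : Subalgebra ℝ C(X, ℝ) := (ContinuousMap.compRightAlgHom ℝ ℝ φ).range
  have hsep : A.SeparatesPoints := fun x y hxy => by
    obtain ⟨i, hi⟩ := Function.ne_iff.1 (hφ.ne hxy)
    exact ⟨(coord i).comp φ, ⟨_, ⟨coord i, rfl⟩, rfl⟩, hi⟩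
  refine (dense_of_separatesPoints hsep n).mono fun F hF => ?_
  choose g hg using hF
  refine ⟨.pi g, ?_⟩
  ext x i
  exact DFunLike.congr_fun (hg i) x

/-- Moving a map slightly towards the centre of the cube makes it take values in the open cube,
which is the range of the logistic map. -/
theorem denseRange_logisticReadout_comp {X : Type*} [TopologicalSpace X] (n : ℕ) :
    DenseRange fun f : C(X, Fin n → ℝ) => (logisticReadout n).comp f := by
  refine fun g => mem_closure_of_forall_isCompact fun K _ ε hε => ?_
  obtain ⟨δ, hδ0, hδ1, hδε⟩ : ∃ δ : ℝ, 0 < δ ∧ δ < 1 ∧ δ < ε :=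
    ⟨min ε 1 / 2, by positivity, by linarith [min_le_right ε 1],
      by linarith [min_le_left ε 1, lt_min hε one_pos]⟩
  let p : ℝ → ℝ := fun y => (1 - δ) * y + δ / 2
  have hp0 : ∀ y : unitInterval, 0 < p y := fun y => by
    have := y.2.1
    have : 0 ≤ (1 - δ) * (y : ℝ) := mul_nonneg (by linarith) this
    simp only [p]; linarith
  have hp1 : ∀ y : unitInterval, p y < 1 := fun y => by
    have := y.2.2
    have : (1 - δ) * (y : ℝ) ≤ (1 - δ) * 1 := by gcongr
    simp only [p]; linarith
  have hq : ∀ y : unitInterval, (p y)⁻¹ - 1 ≠ 0 := fun y => by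
    have := (one_lt_inv₀ (hp0 y)).2 (hp1 y)
    linarith
  have hc : Continuous fun y : unitInterval => -Real.log ((p y)⁻¹ - 1) := by
    refine (Continuous.log ?_ hq).neg
    refine (Continuous.inv₀ ?_ fun y => (hp0 y).ne').sub continuous_const
    fun_prop
  refine ⟨_, ⟨⟨fun x i => -Real.log ((p (g x i))⁻¹ - 1),
    continuous_pi fun i => hc.comp ((continuous_apply i).comp g.continuous)⟩, rfl⟩,
    fun x _ => (dist_pi_lt_iff hε).2 fun i => ?_⟩
  have hv : ((logisticReadout n (fun i => -Real.log ((p (g x i))⁻¹ - 1)) i : unitInterval) : ℝ)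
      = p (g x i) := by
    change Real.sigmoid _ = _
    have := (one_lt_inv₀ (hp0 (g x i))).2 (hp1 (g x i))
    rw [Real.sigmoid_def, neg_neg, Real.exp_log (by linarith)]
    simp
  change dist ((logisticReadout n (fun i => -Real.log ((p (g x i))⁻¹ - 1)) i : unitInterval) : ℝ)
    (g x i) < ε
  rw [hv, Real.dist_eq, abs_lt]
  have h0 := (g x i).2.1
  have h1 := (g x i).2.2
  simp only [p]
  constructor <;> nlinarith

theorem dense_modifiedArchitecture {σ : C(ℝ, ℝ)} (hna : ¬ ∃ a b : ℝ, ∀ t, σ t = a * t + b)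
    {X : Type*} [TopologicalSpace X] {m n : ℕ} (φ : C(X, Fin m → ℝ)) (hφ : Function.Injective φ) :
    Dense (modifiedArchitecture (feedForward σ m n) (logisticReadout n) φ) := by
  have h := ((denseRange_logisticReadout_comp (X := X) n).comp (denseRange_comp_right φ hφ)
    (ContinuousMap.continuous_postcomp _)).dense_image
    ((ContinuousMap.continuous_postcomp _).comp (ContinuousMap.continuous_precomp φ))
    (dense_feedForward hna m n)
  refine h.mono ?_
  rintro _ ⟨f, hf, rfl⟩
  exact ⟨f, hf, rfl⟩

/-! ### Convergent sequences of networks -/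

theorem tendsto_iff_forall_isCompact_dist {X Y : Type*} [TopologicalSpace X] [PseudoMetricSpace Y]
    {ι : Type*} {l : Filter ι} {F : ι → C(X, Y)} {f : C(X, Y)} :
    Tendsto F l (𝓝 f) ↔ ∀ K : Set X, IsCompact K → ∀ ε : ℝ, 0 < ε →
      ∀ᶠ k in l, ∀ x ∈ K, dist (F k x) (f x) < ε := by
  simp_rw [ContinuousMap.tendsto_iff_forall_isCompact_tendstoUniformlyOn,
    Metric.tendstoUniformlyOn_iff, gt_iff_lt, dist_comm]

/-- A continuous function on a subset of `ℝ^m` is a limit of continuous functions on all of `ℝ^m`,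
uniformly on the compact subsets of the subset. The approximants are the Pasch–Hausdorff envelopes
`y ↦ inf_x (h x + k |φ x - y|)`, which increase to `h` pointwise, so that Dini's theorem applies. -/
theorem exists_tendsto_comp_of_isEmbedding {X : Type*} [TopologicalSpace X] {m : ℕ}
    {φ : C(X, Fin m → ℝ)} (hφ : IsEmbedding φ) (h : C(X, unitInterval)) :
    ∃ G : ℕ → C(Fin m → ℝ, unitInterval), Tendsto (fun k => (G k).comp φ) atTop (𝓝 h) := by
  rcases isEmpty_or_nonempty X with hX | hX
  · refine ⟨fun _ => .const _ 0, ?_⟩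
    rw [show (fun _ => (ContinuousMap.const _ 0).comp φ) = fun _ : ℕ => h from
      funext fun _ => ContinuousMap.ext fun x => hX.elim x]
    exact tendsto_const_nhds
  let E : ℕ → (Fin m → ℝ) → ℝ := fun k y => ⨅ x, ((h x : ℝ) + k * dist (φ x) y)
  have hbdd : ∀ (k : ℕ) y, BddBelow (Set.range fun x => (h x : ℝ) + k * dist (φ x) y) := fun k y =>
    ⟨0, by rintro _ ⟨x, rfl⟩; have := (h x).2.1; positivity⟩
  have hle : ∀ k x, E k (φ x) ≤ h x := fun k x => by
    simpa using ciInf_le (hbdd k (φ x)) x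
  have hcont : ∀ k, Continuous (E k) := fun k => by
    refine (LipschitzWith.of_le_add_mul (k : NNReal) fun y y' => ?_).continuous
    rw [← sub_le_iff_le_add]
    refine le_ciInf fun x => ?_
    have h1 := ciInf_le (hbdd k y) x
    have h2 : (k : ℝ) * dist (φ x) y ≤ k * (dist (φ x) y' + dist y y') := by
      gcongr
      rw [dist_comm y]
      exact dist_triangle _ _ _
    have h3 : ((k : NNReal) : ℝ) = k := rfl
    simp only [E, h3] at *
    linarith
  let Φ : ℕ → C(X, ℝ) := fun k => ⟨fun x => E k (φ x), (hcont k).comp φ.continuous⟩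
  have hmono : Monotone Φ := fun k l hkl x => ciInf_mono (hbdd k _) fun x' => by gcongr
  have hlim : Tendsto Φ atTop (𝓝 ⟨fun x => (h x : ℝ), by fun_prop⟩) := by
    refine ContinuousMap.tendsto_of_monotone_of_pointwise hmono fun x => ?_
    refine Metric.tendsto_atTop.2 fun ε hε => ?_
    have hU : {x' | (h x : ℝ) - ε / 2 < h x'} ∈ 𝓝 x :=
      (isOpen_lt continuous_const (by fun_prop)).mem_nhds (by simpa using hε)
    rw [hφ.isInducing.nhds_eq_comap, (Metric.nhds_basis_ball.comap φ).mem_iff] at hU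
    obtain ⟨δ, hδ, hU⟩ := hU
    obtain ⟨N, hN⟩ := exists_nat_gt δ⁻¹
    refine ⟨N, fun k hk => ?_⟩
    have h1 : (h x : ℝ) - ε / 2 ≤ E k (φ x) := le_ciInf fun x' => by
      by_cases hx' : dist (φ x') (φ x) < δ
      · have h2 : (h x : ℝ) - ε / 2 < h x' := hU hx'
        have : 0 ≤ (k : ℝ) * dist (φ x') (φ x) := by positivity
        linarith
      -- far from `x` the penalty term alone exceeds `1`
      · have h2 : 1 ≤ (k : ℝ) * dist (φ x') (φ x) := calc
          1 = δ⁻¹ * δ := by field_simp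
          _ ≤ k * dist (φ x') (φ x) := by
            gcongr
            · exact hN.le.trans (by exact_mod_cast hk)
            · exact not_lt.1 hx'
        linarith [(h x).2.2, (h x').2.1]
    change dist (E k (φ x)) (h x) < ε
    rw [Real.dist_eq, abs_lt]
    constructor <;> linarith [hle k x]
  let p : C(ℝ, unitInterval) := ⟨Set.projIcc 0 1 zero_le_one, continuous_projIcc⟩
  refine ⟨fun k => p.comp ⟨E k, hcont k⟩, ?_⟩
  have hp : p.comp ⟨fun x => (h x : ℝ), by fun_prop⟩ = h :=
    ContinuousMap.ext fun x => Set.projIcc_val zero_le_one (h x)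
  have := (p.continuous_postcomp.tendsto _).comp hlim
  rwa [hp] at this

/-- The `k`-th network is chosen close, on the ball of radius `k` in `ℝ^m`, to the `k`-th of the maps
on `ℝ^m` approximating `s` on `X`; every compact subset of `X` is mapped into such a ball. -/
theorem exists_seq_of_isEmbedding {σ : C(ℝ, ℝ)} (hna : ¬ ∃ a b : ℝ, ∀ t, σ t = a * t + b)
    {X : Type*} [TopologicalSpace X] {m n : ℕ} {φ : C(X, Fin m → ℝ)} (hφ : IsEmbedding φ)
    (s : C(X, Fin n → unitInterval)) :
    ∃ f : ℕ → C(Fin m → ℝ, Fin n → ℝ), (∀ k, f k ∈ feedForward σ m n) ∧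
      Tendsto (fun k => ((logisticReadout n).comp (f k)).comp φ) atTop (𝓝 s) := by
  let ev : Fin n → C(Fin n → unitInterval, unitInterval) := fun i => ⟨_, continuous_apply i⟩
  choose G hG using fun i => exists_tendsto_comp_of_isEmbedding hφ ((ev i).comp s)
  have hnear : ∀ k : ℕ, ∃ f ∈ feedForward σ m n, ∀ y ∈ Metric.closedBall (0 : Fin m → ℝ) k,
      dist (logisticReadout n (f y)) (fun i => G i k y) < 1 / (k + 1 : ℝ) := by
    intro k
    obtain ⟨g, hg, hlim⟩ := mem_closure_iff_seq_limit.1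
      (dense_modifiedArchitecture (n := n) hna (ContinuousMap.id (Fin m → ℝ))
        Function.injective_id (.pi fun i => G i k))
    obtain ⟨l, hl⟩ := (tendsto_iff_forall_isCompact_dist.1 hlim _
      (isCompact_closedBall 0 (k : ℝ)) (1 / (k + 1 : ℝ)) (by positivity)).exists
    obtain ⟨f, hf, hgf⟩ := hg l
    exact ⟨f, hf, fun y hy => by simpa [hgf] using hl y hy⟩
  choose f hf hfG using hnear
  refine ⟨f, hf, tendsto_iff_forall_isCompact_dist.2 fun K hK ε hε => ?_⟩
  obtain ⟨R, hR⟩ := (hK.image φ.continuous).isBounded.subset_closedBall 0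
  obtain ⟨N, hN⟩ := exists_nat_ge R
  have h1 : ∀ᶠ k : ℕ in atTop, ∀ i, ∀ x ∈ K, dist (G i k (φ x)) (s x i) < ε / 2 :=
    eventually_all.2 fun i =>
      tendsto_iff_forall_isCompact_dist.1 (hG i) K hK (ε / 2) (by positivity)
  have h2 : ∀ᶠ k : ℕ in atTop, 1 / (k + 1 : ℝ) < ε / 2 :=
    tendsto_one_div_add_atTop_nhds_zero_nat.eventually_lt_const (by positivity)
  filter_upwards [h1, h2, eventually_ge_atTop N] with k hk1 hk2 hk3 x hx
  have hball : φ x ∈ Metric.closedBall (0 : Fin m → ℝ) k :=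
    Metric.closedBall_subset_closedBall (hN.trans (by exact_mod_cast hk3)) (hR ⟨x, hx, rfl⟩)
  have h3 : dist (fun i => G i k (φ x)) (s x) < ε / 2 :=
    (dist_pi_lt_iff (by positivity)).2 fun i => hk1 i x hx
  calc dist (logisticReadout n (f k (φ x))) (s x)
      ≤ dist (logisticReadout n (f k (φ x))) (fun i => G i k (φ x))
        + dist (fun i => G i k (φ x)) (s x) := dist_triangle _ _ _
    _ < ε := by linarith [hfG k _ hball]

/-- When `X` is locally compact and `σ`-compact, `C(X, [0,1]^n)` is first countable, so that density
yields convergent sequences. -/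
theorem exists_seq_of_sigmaCompact {σ : C(ℝ, ℝ)} (hna : ¬ ∃ a b : ℝ, ∀ t, σ t = a * t + b)
    {X : Type*} [TopologicalSpace X] [LocallyCompactSpace X] [SigmaCompactSpace X] {m n : ℕ}
    (φ : C(X, Fin m → ℝ)) (hφ : Function.Injective φ) (s : C(X, Fin n → unitInterval)) :
    ∃ f : ℕ → C(Fin m → ℝ, Fin n → ℝ), (∀ k, f k ∈ feedForward σ m n) ∧
      Tendsto (fun k => ((logisticReadout n).comp (f k)).comp φ) atTop (𝓝 s) := by
  obtain ⟨g, hg, hlim⟩ := mem_closure_iff_seq_limit.1 (dense_modifiedArchitecture hna φ hφ s)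
  choose f hf hgf using hg
  refine ⟨f, hf, ?_⟩
  rwa [funext hgf] at hlim

/-! ### Soft and hard classifiers -/

/-- An open subset of a metric space is the superlevel set `{s > α}` of a continuous function with
values in `[α, 1]`, built from the distance to the complement. -/
theorem exists_soft_classifier {X : Type*} [MetricSpace X] {U : Set X} (hU : IsOpen U) {α : ℝ}
    (hα : α ∈ Set.Ioo (0 : ℝ) 1) :
    ∃ s : C(X, unitInterval), ∀ x, (s x : ℝ) ∈ Set.Ioc α 1 ↔ x ∈ U := by
  rcases Uᶜ.eq_empty_or_nonempty with h | h
  -- `infDist` to the empty set is `0` by convention, so `U = X` has to be treated apart.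
  · rw [Set.compl_empty_iff] at h
    exact ⟨.const _ 1, fun x => by simp [h, hα.2]⟩
  have h0 : ∀ x, 0 ≤ min 1 (Metric.infDist x Uᶜ) := fun x =>
    le_min zero_le_one Metric.infDist_nonneg
  have hle : ∀ x, α + (1 - α) * min 1 (Metric.infDist x Uᶜ) ≤ 1 := fun x => by
    nlinarith [min_le_left 1 (Metric.infDist x Uᶜ), hα.2]
  have hc : Continuous fun x => α + (1 - α) * min 1 (Metric.infDist x Uᶜ) := by
    have := Metric.continuous_infDist_pt Uᶜ
    fun_prop
  refine ⟨⟨fun x => ⟨α + (1 - α) * min 1 (Metric.infDist x Uᶜ), ?_, hle x⟩, hc.subtype_mk _⟩,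
    fun x => ?_⟩
  · have := mul_nonneg (sub_nonneg.2 hα.2.le) (h0 x)
    linarith [hα.1]
  · change α < α + (1 - α) * min 1 (Metric.infDist x Uᶜ) ∧
      α + (1 - α) * min 1 (Metric.infDist x Uᶜ) ≤ 1 ↔ _
    rw [and_iff_left (hle x), lt_add_iff_pos_right, mul_pos_iff_of_pos_left (sub_pos.2 hα.2),
      lt_min_iff, and_iff_right one_pos, ← hU.isClosed_compl.notMem_iff_infDist_pos h,
      Set.mem_compl_iff, not_not]

theorem idealClassifier_eq_threshold_comp {X : Type*} [TopologicalSpace X] {n : ℕ}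
    {U : Fin n → Set X} (hU : ∀ i, IsOpen (U i)) {α : ℝ} {s : Fin n → C(X, unitInterval)}
    (hs : ∀ i, s i ⁻¹' {t | (t : ℝ) ∈ Set.Ioc α 1} = U i) :
    idealClassifier U hU = (threshold n α).comp (ContinuousMap.pi s) := by
  ext x i
  change x ∈ U i ↔ (s i x : ℝ) ∈ Set.Ioc α 1
  rw [← hs i]
  rfl

end UniversalClassification

theorem mainTheorem9 {X : Type*} [MetricSpace X] {m n : ℕ}
    (U : Fin n → Set X) (hU : ∀ i, IsOpen (U i))
    (φ : C(X, Fin m → ℝ)) (hφ : Function.Injective φ)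
    (σ : ℝ → ℝ) (hσ : Continuous σ) (hσ_affine : ¬ ∃ a b : ℝ, ∀ t, σ t = a * t + b)
    (α : ℝ) (hα : α ∈ Set.Ioo (0 : ℝ) 1) :
    -- hard-soft decomposition
    (∃ s : Fin n → C(X, unitInterval),
      UniversalClassification.idealClassifier U hU =
        (UniversalClassification.threshold n α).comp (ContinuousMap.pi s) ∧
      ∀ i, s i ⁻¹' {t | (t : ℝ) ∈ Set.Ioc α 1} = U i) ∧
    -- universal classification, for every such soft classifier `s`
    ((Topology.IsEmbedding φ ∨ (LocallyCompactSpace X ∧ SigmaCompactSpace X)) →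
      ∀ s : Fin n → C(X, unitInterval),
        (∀ i, s i ⁻¹' {t | (t : ℝ) ∈ Set.Ioc α 1} = U i) →
        ∃ f : ℕ → C(Fin m → ℝ, Fin n → ℝ),
          (∀ k, f k ∈ UniversalClassification.feedForward σ m n) ∧
          -- soft classification
          (∀ κ : Set X, IsCompact κ → κ.Nonempty → ∀ ε : ℝ, 0 < ε → ∃ K : ℕ, ∀ k ≥ K,
            ∀ x ∈ κ, ∀ i,
              |(UniversalClassification.logisticReadout n (f k (φ x)) i : ℝ) - (s i x : ℝ)| < ε) ∧
          -- hard classification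
          Filter.Tendsto
            (fun k => (UniversalClassification.threshold n α).comp
              (((UniversalClassification.logisticReadout n).comp (f k)).comp φ))
            Filter.atTop (nhds (UniversalClassification.idealClassifier U hU))) ∧
    -- density in `C(X, [0,1]^n)`
    Dense (UniversalClassification.modifiedArchitecture
      (UniversalClassification.feedForward σ m n)
      (UniversalClassification.logisticReadout n) φ) := by
  have hna : ¬ ∃ a b : ℝ, ∀ t, (⟨σ, hσ⟩ : C(ℝ, ℝ)) t = a * t + b := hσ_affine
  refine ⟨?_, fun hX s hs => ?_, UniversalClassification.dense_modifiedArchitecture hna φ hφ⟩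
  · choose s hs using fun i => UniversalClassification.exists_soft_classifier (hU i) hα
    have hs' : ∀ i, s i ⁻¹' {t | (t : ℝ) ∈ Set.Ioc α 1} = U i := fun i => Set.ext (hs i)
    exact ⟨s, UniversalClassification.idealClassifier_eq_threshold_comp hU hs', hs'⟩
  · obtain ⟨f, hf, hlim⟩ : ∃ f : ℕ → C(Fin m → ℝ, Fin n → ℝ),
        (∀ k, f k ∈ UniversalClassification.feedForward σ m n) ∧
        Filter.Tendsto (fun k => ((UniversalClassification.logisticReadout n).comp (f k)).comp φ)
          Filter.atTop (nhds (ContinuousMap.pi s)) := by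
      rcases hX with hX | ⟨h1, h2⟩
      · exact UniversalClassification.exists_seq_of_isEmbedding hna hX _
      · exact UniversalClassification.exists_seq_of_sigmaCompact hna φ hφ _
    refine ⟨f, hf, fun κ hκ _ ε hε => ?_, ?_⟩
    · obtain ⟨K, hK⟩ := Filter.eventually_atTop.1
        (UniversalClassification.tendsto_iff_forall_isCompact_dist.1 hlim κ hκ ε hε)
      exact ⟨K, fun k hk x hx i => (dist_pi_lt_iff hε).1 (hK k hk x hx) i⟩
    -- thresholding is continuous into the Sierpiński cube, so it preserves the convergence
    · rw [UniversalClassification.idealClassifier_eq_threshold_comp hU hs]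
      exact ((ContinuousMap.continuous_postcomp _).tendsto _).comp hlim
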